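/- Let $a,b\in\mathbb{R}$ with $b\neq 0$ and let $T>0$. Let $B=(B_t)_{t\in\mathbb{R}}$ be a two-sided Brownian motion and let $B'=(B'_t)_{t\in\mathbb{R}}$ be a fractional Brownian motion with Hurst index $H=3/4$, independent of $B$; that is, $B'$ is a centered Gaussian process with stationary increments, $B'_0=0$ almost surely and $\mathbb{E}[(B'_t)^2]=|t|^{2H}=|t|^{3/2}$ for all $t\in\mathbb{R}$. Let $$S_t=S_t^{3/4}(a,b)=\frac{a\,(B_t+B_{-t})+b\,(B'_t+B'_{-t})}{\sqrt 2},\qquad t\ge 0,$$ be the sub-mixed fractional Brownian motion with parameters $a$, $b$ and $H=3/4$. Then $(S_t)_{0\le t\le T}$ is not a quasi-martingale. Here a process $(X_t)_{0\le t\le T}$ with natural filtration $\mathcal{F}^X_t=\sigma(X_s:\ 0\le s\le t)$ is called a quasi-martingale if $X_t\in L^1$ for every $t\in[0,T]$ and $$\sup\ \sum_{j=0}^{n-1}\bigl\|\mathbb{E}\bigl(X_{t_{j+1}}-X_{t_j}\,\big|\,\mathcal{F}^X_{t_j}\bigr)\bigr\|_{1}<+\infty,$$ where the supremum is over all finite partitions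 $0=t_0<t_1<\dots<t_n=T$ of $[0,T]$. -/

import Mathlib

open MeasureTheory ProbabilityTheory
open scoped NNReal ENNReal

/-- `B` is a (two-sided) fractional Brownian motion with Hurst index `H ∈ (0,1)` under `P`: a centered
Gaussian process with stationary increments, with `B 0 = 0` almost surely and
`E (B t)² = |t|^(2H)` for every real `t`. -/
structure IsFractionalBrownianMotion {Ω : Type*} [MeasurableSpace Ω] (H : ℝ) (B : ℝ → Ω → ℝ)
    (P : Measure Ω) : Prop where
  hurst_mem : H ∈ Set.Ioo (0 : ℝ) 1
  measurable : ∀ t, Measurable (B t)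
  isGaussianProcess : IsGaussianProcess B P
  centered : ∀ t, ∫ ω, B t ω ∂P = 0
  stationary_increments : ∀ (h : ℝ) (I : Finset ℝ),
    IdentDistrib (fun ω (t : I) ↦ B ((t : ℝ) + h) ω - B h ω)
      (fun ω (t : I) ↦ B (t : ℝ) ω - B 0 ω) P P
  zero_ae : ∀ᵐ ω ∂P, B 0 ω = 0
  second_moment : ∀ t, ∫ ω, (B t ω) ^ 2 ∂P = |t| ^ (2 * H)

/-- `B` has the law of a two-sided Brownian motion under `P`: its two halves `(B t)_{t ≥ 0}` and
`(B (-t))_{t ≥ 0}` are independent and have the finite-dimensional laws of Brownian motion.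
Continuity of the paths is not required. -/
structure IsTwoSidedPreBrownian {Ω : Type*} [MeasurableSpace Ω] (B : ℝ → Ω → ℝ)
    (P : Measure Ω) : Prop where
  measurable : ∀ t, Measurable (B t)
  right : IsPreBrownianReal (fun t : ℝ≥0 ↦ B (t : ℝ)) P
  left : IsPreBrownianReal (fun t : ℝ≥0 ↦ B (-(t : ℝ))) P
  indep : IndepFun (fun ω (t : ℝ≥0) ↦ B (t : ℝ) ω) (fun ω (t : ℝ≥0) ↦ B (-(t : ℝ)) ω) P

/-- The process `S_t(a,b) = (a (B_t + B_{-t}) + b (B'_t + B'_{-t})) / √2`, `t ≥ 0`. It is the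
sub-mixed fractional Brownian motion with parameters `a`, `b`, `H` when `B` is a Brownian motion and
`B'` is an independent fractional Brownian motion with Hurst index `H`. -/
noncomputable def subMixedProcess {Ω : Type*} (a b : ℝ) (B B' : ℝ → Ω → ℝ) (t : ℝ≥0) (ω : Ω) : ℝ :=
  (a * (B (t : ℝ) ω + B (-(t : ℝ)) ω) + b * (B' (t : ℝ) ω + B' (-(t : ℝ)) ω)) / Real.sqrt 2

/-- `S` is a sub-mixed fractional Brownian motion with parameters `a`, `b`, `H` under `P`. -/
def IsSubMixedFBM {Ω : Type*} [MeasurableSpace Ω] (a b H : ℝ) (S : ℝ≥0 → Ω → ℝ)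
    (P : Measure Ω) : Prop :=
  ∃ B B' : ℝ → Ω → ℝ, IsTwoSidedPreBrownian B P ∧ IsFractionalBrownianMotion H B' P ∧
    IndepFun (fun ω t ↦ B t ω) (fun ω t ↦ B' t ω) P ∧ S = subMixedProcess a b B B'

/-- A process `(X_t)_{0 ≤ t ≤ T}` is a quasi-martingale (for its own filtration) if every `X_t` is
integrable and the sums `∑ ‖E (X_{t_{j+1}} - X_{t_j} | F_{t_j})‖₁` have a finite supremum over all
finite partitions `0 = t_0 < t_1 < ... < t_n = T`. -/
def IsQuasiMartingale {Ω : Type*} [MeasurableSpace Ω] {T : ℝ≥0} (X : Set.Iic T → Ω → ℝ)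
    (P : Measure Ω) : Prop :=
  ∃ hX : ∀ t, StronglyMeasurable (X t),
    (∀ t, Integrable (X t) P) ∧
    (⨆ (n : ℕ) (t : Fin (n + 1) → Set.Iic T)
      (_ : StrictMono t ∧ (t 0 : ℝ≥0) = 0 ∧ (t (Fin.last n) : ℝ≥0) = T),
      ∑ j : Fin n, eLpNorm
        (condExp (Filtration.natural X hX (t j.castSucc)) P
          (X (t j.succ) - X (t j.castSucc))) 1 P) < ∞

/-!
The sums in the definition of a quasi-martingale are bounded below along uniform partitions of
`[0, T]`. Write `δ = T / (4 M)` for the mesh and `Δ_k` for the increment of `S` over the `k`-th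
interval.

If `(X, Y)` is a centered Gaussian pair and `Y` is measurable for a σ-algebra `m`, then
`‖E (X | m)‖₁ ≥ E (X sign Y) = κ cov (X, Y) / √(Var Y)` with `κ = E |N(0, 1)|`, since the residual of
the regression of `X` on `Y` is independent of `Y`
(`ofReal_integral_mul_le_eLpNorm_condExp`, `HasGaussianLaw.integral_mul_sign`). So one good linear
functional `Y` of the past suffices for each increment.

Let `ψ x = |x| ^ (3 / 2)` and let `φ` be half the second difference of `ψ`. Then
`cov (Δ_j, Δ_k) = a² δ 1_{j = k} + b² ψ(δ) (φ (j - k) - φ (j + k + 1))`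
(`IsSubMixedFBM.covariance_gridIncrement`), and `φ n` has the order of `n ^ (-1 / 2)`. The exponent
`3 / 4` is critical: the squares of these covariances sum like the harmonic series. For
`3 M ≤ j < 4 M` take `Y = ∑_{i < M} (i + 1) ^ (-1 / 2) Δ_{j - 1 - i}`, and let `H_M` be the `M`-th
harmonic sum.

* The covariance of `Δ_j` and `Y` is at least `b² ψ(δ) H_M / 16`. The reflected term
  `φ (j + k + 1)` is harmless because `j` is large compared with `j - k`.
* The variance of `Y` is at most `δ H_M (a² + b² √T)`, by Schur's test: the row sums of `φ` telescope
  and are at most `2 √M`, while `ψ(δ) √M` has the order of `δ`.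

Hence each of the `M` terms with `3 M ≤ j < 4 M` is at least a constant times `δ √H_M`. As `M δ = T / 4`,
their sum is at least a constant times `√H_M`, which is unbounded.
-/

/-! ### The covariance function of fractional Gaussian noise with Hurst index `3 / 4` -/

/-- The function `x ↦ |x| ^ (3 / 2)`, the variance function of a fractional Brownian motion with
Hurst index `3 / 4`. -/
noncomputable def fbmVar (x : ℝ) : ℝ := |x| ^ (3 / 2 : ℝ)

/-- Half the second difference of `fbmVar`. At an integer `x` it is the covariance of two increments
of a fractional Brownian motion (`H = 3 / 4`) over unit intervals at distance `x`. -/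
noncomputable def noiseCov (x : ℝ) : ℝ := (fbmVar (x + 1) + fbmVar (x - 1) - 2 * fbmVar x) / 2

lemma fbmVar_of_nonneg {x : ℝ} (hx : 0 ≤ x) : fbmVar x = x * √x := by
  rw [fbmVar, abs_of_nonneg hx, show (3 / 2 : ℝ) = 1 + 1 / 2 by norm_num,
    Real.rpow_add_of_nonneg hx (by norm_num) (by norm_num), Real.rpow_one, Real.sqrt_eq_rpow]

lemma fbmVar_neg (x : ℝ) : fbmVar (-x) = fbmVar x := by rw [fbmVar, abs_neg, fbmVar]

lemma fbmVar_mul (x y : ℝ) : fbmVar (x * y) = fbmVar x * fbmVar y := by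
  rw [fbmVar, abs_mul, Real.mul_rpow (abs_nonneg _) (abs_nonneg _), fbmVar, fbmVar]

lemma noiseCov_neg (x : ℝ) : noiseCov (-x) = noiseCov x := by
  rw [noiseCov, noiseCov, ← fbmVar_neg (-x + 1), ← fbmVar_neg (-x - 1), ← fbmVar_neg (-x)]
  ring_nf

/-- With `u = √(x + 1) * √(x - 1)`, twice `noiseCov x` is `(√(x + 1) + √(x - 1)) (2 x - u) - 2 x √x`,
and the square of its first term times `x` is a polynomial in `x` and `u`. -/
lemma exists_noiseCov_mul_sqrt {x : ℝ} (hx : 1 ≤ x) :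
    ∃ u w : ℝ, 0 ≤ u ∧ u ^ 2 = x ^ 2 - 1 ∧ 0 ≤ w ∧
      w ^ 2 = 2 * x ^ 4 + 6 * x ^ 2 + 2 * (x * u) * (x ^ 2 - 1) ∧
      noiseCov x * √x = w / 2 - x ^ 2 := by
  have hp := Real.sq_sqrt (show 0 ≤ x + 1 by linarith)
  have hq := Real.sq_sqrt (show 0 ≤ x - 1 by linarith)
  have hr := Real.sq_sqrt (show 0 ≤ x by linarith)
  have hφ : noiseCov x = ((x + 1) * √(x + 1) + (x - 1) * √(x - 1) - 2 * (x * √x)) / 2 := by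
    rw [noiseCov, fbmVar_of_nonneg (by linarith), fbmVar_of_nonneg (by linarith),
      fbmVar_of_nonneg (by linarith)]
  set p := √(x + 1)
  set q := √(x - 1)
  set r := √x
  have hp0 : 0 ≤ p := Real.sqrt_nonneg _
  have hq0 : 0 ≤ q := Real.sqrt_nonneg _
  have hr0 : 0 ≤ r := Real.sqrt_nonneg _
  have hu : (p * q) ^ 2 = x ^ 2 - 1 := by rw [mul_pow, hp, hq]; ring
  refine ⟨p * q, ((x + 1) * p + (x - 1) * q) * r, by positivity, hu, ?_, ?_, ?_⟩
  · have : 0 ≤ x - 1 := by linarith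
    have : 0 ≤ x + 1 := by linarith
    positivity
  · have : (((x + 1) * p + (x - 1) * q) * r) ^ 2
        = ((x + 1) ^ 2 * p ^ 2 + (x - 1) ^ 2 * q ^ 2 + 2 * (x ^ 2 - 1) * (p * q)) * r ^ 2 := by ring
    rw [this, hp, hq, hr]; ring
  · rw [hφ]
    linear_combination (-x) * hr

lemma div_sqrt_le_noiseCov {x : ℝ} (hx : 1 ≤ x) : 5 / 16 / √x ≤ noiseCov x := by
  obtain ⟨u, w, hu0, hu, hw0, hw, h⟩ := exists_noiseCov_mul_sqrt hx
  have hx0 : 0 < √x := Real.sqrt_pos.2 (by linarith)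
  rw [div_le_iff₀ hx0, h]
  have hxu : 0 ≤ x * u := by positivity
  have hy : 1 ≤ x ^ 2 := by nlinarith
  have : 2 * x ^ 2 + 5 / 8 ≤ w := by
    apply le_of_sq_le_sq _ hw0
    rw [hw]
    -- for `x ^ 2 ≤ 9 / 8` the term with `x * u` is not needed, and its bound below would fail
    rcases le_total (x ^ 2) (9 / 8) with h9 | h9
    · nlinarith [mul_nonneg hxu (sub_nonneg.2 hy)]
    · have : x ^ 2 - 3 / 4 ≤ x * u := by
        apply le_of_sq_le_sq _ hxu
        rw [mul_pow, hu]; nlinarith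
      nlinarith [mul_le_mul_of_nonneg_right this (sub_nonneg.2 hy)]
  linarith

lemma noiseCov_le_div_sqrt {x : ℝ} (hx : 1 ≤ x) : noiseCov x ≤ 1 / 2 / √x := by
  obtain ⟨u, w, hu0, hu, hw0, hw, h⟩ := exists_noiseCov_mul_sqrt hx
  have hx0 : 0 < √x := Real.sqrt_pos.2 (by linarith)
  rw [le_div_iff₀ hx0, h]
  have hy : 1 ≤ x ^ 2 := by nlinarith
  have : w ≤ 2 * x ^ 2 + 1 := by
    apply le_of_sq_le_sq _ (by positivity)
    rw [hw]
    have : x * u ≤ x ^ 2 - 1 / 2 := by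
      apply le_of_sq_le_sq _ (by linarith)
      rw [mul_pow, hu]; nlinarith
    nlinarith [mul_le_mul_of_nonneg_right this (sub_nonneg.2 hy)]
  linarith

lemma noiseCov_natCast_nonneg (n : ℕ) : 0 ≤ noiseCov n := by
  rcases Nat.eq_zero_or_pos n with rfl | hn
  · simp [noiseCov, fbmVar]
  · exact le_trans (by positivity) (div_sqrt_le_noiseCov (by exact_mod_cast hn))

lemma noiseCov_natCast_sub_nonneg (m n : ℕ) : 0 ≤ noiseCov ((m : ℝ) - n) := by
  rcases le_total n m with h | h
  · rw [← Nat.cast_sub h]; exact noiseCov_natCast_nonneg _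
  · rw [← noiseCov_neg, neg_sub, ← Nat.cast_sub h]; exact noiseCov_natCast_nonneg _

lemma fbmVar_add_one_sub_le {x y : ℝ} (hx : 0 ≤ x) (hxy : x + 1 ≤ y) :
    fbmVar (x + 1) - fbmVar x ≤ 2 * √y := by
  refine le_trans ?_ (mul_le_mul_of_nonneg_left (Real.sqrt_le_sqrt hxy) zero_le_two)
  rw [fbmVar_of_nonneg hx, fbmVar_of_nonneg (by linarith)]
  have hp := Real.sq_sqrt (show 0 ≤ x + 1 by linarith)
  have hq := Real.sq_sqrt hx
  have hpq : √x ≤ √(x + 1) := Real.sqrt_le_sqrt (by linarith)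
  have hq0 := Real.sqrt_nonneg x
  set p := √(x + 1)
  set q := √x
  have h1 : p ^ 2 - q ^ 2 = 1 := by rw [hp, hq]; ring
  -- as `p ^ 2 - q ^ 2 = 1`, the claim is the homogeneous `p ^ 3 - q ^ 3 ≤ 2 p (p ^ 2 - q ^ 2)`
  have : 2 * p * (p ^ 2 - q ^ 2) - (p ^ 2 * p - q ^ 2 * q) = (p - q) * (p * p + p * q - q * q) := by
    ring
  have h2 : 0 ≤ (p - q) * (p * p + p * q - q * q) := by
    apply mul_nonneg (by linarith)
    nlinarith
  rw [← hp, ← hq]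
  rw [h1] at this
  linarith

/-- The sum telescopes, `noiseCov` being a second difference. -/
lemma sum_noiseCov_le {M i : ℕ} (hi : i < M) :
    ∑ l ∈ Finset.range M, noiseCov ((l : ℝ) - i) ≤ 2 * √M := by
  have h1 : ∑ l ∈ Finset.range M, noiseCov ((l : ℝ) - i)
      = ∑ l ∈ Finset.range M, ((fbmVar (((l + 1 : ℕ) : ℝ) - i) - fbmVar (((l + 1 : ℕ) : ℝ) - i - 1)) / 2
        - (fbmVar ((l : ℝ) - i) - fbmVar ((l : ℝ) - i - 1)) / 2) := by
    refine Finset.sum_congr rfl fun l _ ↦ ?_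
    rw [noiseCov, Nat.cast_add_one, show (l : ℝ) + 1 - i = l - i + 1 by ring,
      show (l : ℝ) - i + 1 - 1 = l - i by ring]
    ring
  rw [h1, Finset.sum_range_sub (fun l : ℕ ↦ (fbmVar ((l : ℝ) - i) - fbmVar ((l : ℝ) - i - 1)) / 2)]
  have hi' : (i : ℝ) + 1 ≤ M := by exact_mod_cast hi
  have h2 := fbmVar_add_one_sub_le (x := M - i - 1) (y := M) (by linarith)
    (by linarith [(Nat.cast_nonneg i : (0 : ℝ) ≤ i)])
  have h3 := fbmVar_add_one_sub_le (x := i) (y := M) (Nat.cast_nonneg i) hi'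
  rw [sub_add_cancel] at h2
  rw [Nat.cast_zero, show (0 : ℝ) - i - 1 = -(i + 1) by ring, zero_sub, fbmVar_neg, fbmVar_neg]
  linarith

/-- The reflected term of the covariance of increments takes away only a part of the main one. -/
lemma noiseCov_sub_noiseCov_ge {x y : ℝ} (hx : 1 ≤ x) (hxy : 4 * x ≤ y) :
    1 / 16 / √x ≤ noiseCov x - noiseCov y := by
  have hx0 : 0 < √x := Real.sqrt_pos.2 (by linarith)
  have h1 : 2 * √x ≤ √y := by
    apply Real.le_sqrt_of_sq_le
    rw [mul_pow, Real.sq_sqrt (by linarith)]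
    linarith
  have h2 : 1 / 2 / √y ≤ 1 / 4 / √x := by
    rw [div_le_div_iff₀ (by linarith) hx0]
    linarith
  have h3 := div_sqrt_le_noiseCov hx
  have h4 := noiseCov_le_div_sqrt (show 1 ≤ y by linarith)
  have h5 : 1 / 16 / √x = 5 / 16 / √x - 1 / 4 / √x := by ring
  linarith

/-- Schur's test for a symmetric kernel with nonnegative entries. -/
lemma sum_sum_mul_le_of_row_sum_le {ι : Type*} {s : Finset ι} {k : ι → ι → ℝ} {w : ι → ℝ} {C : ℝ}
    (hk : ∀ i ∈ s, ∀ j ∈ s, 0 ≤ k i j) (hsymm : ∀ i ∈ s, ∀ j ∈ s, k i j = k j i)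
    (hC : ∀ i ∈ s, ∑ j ∈ s, k j i ≤ C) :
    ∑ i ∈ s, ∑ j ∈ s, w i * w j * k i j ≤ C * ∑ i ∈ s, w i ^ 2 := by
  have h1 : ∑ i ∈ s, ∑ j ∈ s, w i ^ 2 * k j i ≤ C * ∑ i ∈ s, w i ^ 2 := by
    rw [Finset.mul_sum]
    refine Finset.sum_le_sum fun i hi ↦ ?_
    rw [← Finset.mul_sum, mul_comm]
    exact mul_le_mul_of_nonneg_right (hC i hi) (sq_nonneg _)
  have h2 : ∑ i ∈ s, ∑ j ∈ s, w j ^ 2 * k i j ≤ C * ∑ i ∈ s, w i ^ 2 := by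
    rw [Finset.sum_comm]; exact h1
  have h3 : ∑ i ∈ s, ∑ j ∈ s, w i * w j * k i j
      ≤ ∑ i ∈ s, ∑ j ∈ s, (w i ^ 2 * k j i / 2 + w j ^ 2 * k i j / 2) := by
    refine Finset.sum_le_sum fun i hi ↦ Finset.sum_le_sum fun j hj ↦ ?_
    rw [← hsymm i hi j hj]
    nlinarith [mul_nonneg (sq_nonneg (w i - w j)) (hk i hi j hj)]
  simp_rw [Finset.sum_add_distrib, ← Finset.sum_div] at h3
  linarith

/-! ### Gaussian pairs and conditional expectations -/

lemma ProbabilityTheory.IsGaussianProcess.add_of_indepFun {Ω T : Type*} [MeasurableSpace Ω]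
    {P : Measure Ω} {X Y : T → Ω → ℝ} (hX : IsGaussianProcess X P) (hY : IsGaussianProcess Y P)
    (h : IndepFun (fun ω t ↦ X t ω) (fun ω t ↦ Y t ω) P) :
    IsGaussianProcess (fun t ω ↦ X t ω + Y t ω) P where
  hasGaussianLaw I := by
    have hI : Measurable (fun f : T → ℝ ↦ I.restrict f) := by fun_prop
    exact ((h.comp hI hI).hasGaussianLaw (hX.hasGaussianLaw I) (hY.hasGaussianLaw I)).add

lemma ProbabilityTheory.IsGaussianProcess.hasGaussianLaw_prodMk_sum {Ω T ι : Type*}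
    [MeasurableSpace Ω] {P : Measure Ω} {X : T → Ω → ℝ} (hX : IsGaussianProcess X P) (t : T)
    (s : Finset ι) (c : ι → ℝ) (v : ι → T) :
    HasGaussianLaw (fun ω ↦ (X t ω, ∑ i ∈ s, c i * X (v i) ω)) P := by
  classical
  let I : Finset T := insert t (s.image v)
  let e (r : T) : (I → ℝ) →L[ℝ] ℝ := if h : r ∈ I then .proj ⟨r, h⟩ else 0
  have he (r : T) (hr : r ∈ I) (ω : Ω) : e r (I.restrict (X · ω)) = X r ω := by simp [e, hr]
  convert! (hX.hasGaussianLaw I).map_fun ((e t).prod (∑ i ∈ s, c i • e (v i))) using 2 with ω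
  simp only [ContinuousLinearMap.prod_apply, sum_apply, smul_apply, smul_eq_mul]
  rw [he _ (Finset.mem_insert_self _ _)]
  congr 1
  refine Finset.sum_congr rfl fun i hi ↦ ?_
  rw [he _ (Finset.mem_insert_of_mem (Finset.mem_image_of_mem _ hi))]

/-- The first absolute moment of a standard Gaussian variable. -/
noncomputable def gaussianAbsMoment : ℝ := ∫ x, |x| ∂(gaussianReal 0 1)

lemma gaussianAbsMoment_pos : 0 < gaussianAbsMoment := by
  have hint : Integrable (fun x : ℝ ↦ |x|) (gaussianReal 0 1) :=
    (memLp_one_iff_integrable.1 (memLp_id_gaussianReal 1)).abs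
  rw [gaussianAbsMoment, integral_pos_iff_support_of_nonneg (fun x ↦ abs_nonneg x) hint]
  have : Function.support (fun x : ℝ ↦ |x|) = {0}ᶜ := by ext; simp
  rw [this]
  have := nullSingletonClass_gaussianReal (μ := 0) (v := 1) one_ne_zero
  rw [prob_compl_eq_one_sub (measurableSet_singleton 0), measure_singleton]
  simp

lemma ProbabilityTheory.HasGaussianLaw.integral_abs {Ω : Type*} [MeasurableSpace Ω] {P : Measure Ω}
    {Y : Ω → ℝ} (hY : HasGaussianLaw Y P) (h0 : P[Y] = 0) :
    ∫ ω, |Y ω| ∂P = √(Var[Y; P]) * gaussianAbsMoment := by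
  have h1 : P.map Y = (gaussianReal 0 1).map (√(Var[Y; P]) * ·) := by
    rw [hY.map_eq_gaussianReal, h0, gaussianReal_map_const_mul, mul_zero, mul_one]
    congr 1
    ext
    simp [Real.sq_sqrt (variance_nonneg Y P), variance_nonneg]
  calc ∫ ω, |Y ω| ∂P = ∫ x, |x| ∂(P.map Y) :=
        (integral_map hY.aemeasurable (by fun_prop)).symm
    _ = ∫ x, |√(Var[Y; P]) * x| ∂(gaussianReal 0 1) := by
        rw [h1, integral_map (by fun_prop) (by fun_prop)]
    _ = √(Var[Y; P]) * gaussianAbsMoment := by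
        simp_rw [abs_mul, abs_of_nonneg (Real.sqrt_nonneg _)]
        rw [integral_const_mul, gaussianAbsMoment]

lemma Real.measurable_sign : Measurable Real.sign :=
  Measurable.ite measurableSet_Iio measurable_const
    (Measurable.ite measurableSet_Ioi measurable_const measurable_const)

lemma Real.norm_sign_le_one (x : ℝ) : ‖Real.sign x‖ ≤ 1 := by
  rcases Real.sign_apply_eq x with h | h | h <;> simp [h]

/-- For a centered Gaussian pair, `E [X sign Y]` is that of the regression of `X` on `Y`, because the
residual is independent of `Y`. -/
lemma ProbabilityTheory.HasGaussianLaw.integral_mul_sign {Ω : Type*} [MeasurableSpace Ω]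
    {P : Measure Ω} {X Y : Ω → ℝ} (hXY : HasGaussianLaw (fun ω ↦ (X ω, Y ω)) P)
    (hX0 : P[X] = 0) (hY0 : P[Y] = 0) (hVar : 0 < Var[Y; P]) :
    ∫ ω, X ω * Real.sign (Y ω) ∂P = gaussianAbsMoment * (cov[X, Y; P] / √(Var[Y; P])) := by
  have := hXY.isProbabilityMeasure
  have hX := hXY.fst
  have hY := hXY.snd
  set c := cov[X, Y; P] / Var[Y; P] with hc
  have hsY : AEStronglyMeasurable (fun ω ↦ Real.sign (Y ω)) P :=
    (Real.measurable_sign.comp_aemeasurable hY.aemeasurable).aestronglyMeasurable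
  have hZY : HasGaussianLaw (fun ω ↦ (X ω - c * Y ω, Y ω)) P :=
    hXY.map_fun ((ContinuousLinearMap.fst ℝ ℝ ℝ - c • ContinuousLinearMap.snd ℝ ℝ ℝ).prod
      (ContinuousLinearMap.snd ℝ ℝ ℝ))
  have hind : IndepFun (fun ω ↦ X ω - c * Y ω) Y P := by
    apply hZY.indepFun_of_covariance_eq_zero
    rw [covariance_fun_sub_left hX.memLp_two (hY.memLp_two.const_mul c) hY.memLp_two,
      covariance_const_mul_left, covariance_self hY.aemeasurable, hc, div_mul_cancel₀ _ hVar.ne',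
      sub_self]
  have h1 : ∫ ω, (X ω - c * Y ω) * Real.sign (Y ω) ∂P = 0 := by
    have := (hind.comp measurable_id Real.measurable_sign).integral_fun_mul_eq_mul_integral
      hZY.fst.aemeasurable.aestronglyMeasurable hsY
    simp only [Function.comp_def, id] at this
    rw [this, integral_sub hX.integrable (hY.integrable.const_mul c), integral_const_mul, hX0, hY0]
    simp
  have h2 : ∫ ω, (c * Y ω) * Real.sign (Y ω) ∂P = c * (√(Var[Y; P]) * gaussianAbsMoment) := by
    rw [← hY.integral_abs hY0, ← integral_const_mul]
    congr with ω
    rw [mul_assoc]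
    congr 1
    rcases lt_trichotomy (Y ω) 0 with h | h | h
    · rw [Real.sign_of_neg h, abs_of_neg h]; ring
    · simp [h]
    · rw [Real.sign_of_pos h, abs_of_pos h]; ring
  have h3 : ∫ ω, X ω * Real.sign (Y ω) ∂P
      = ∫ ω, (X ω - c * Y ω) * Real.sign (Y ω) ∂P + ∫ ω, (c * Y ω) * Real.sign (Y ω) ∂P := by
    rw [← integral_add]
    · congr with ω; ring
    · exact hZY.fst.integrable.mul_bdd hsY (.of_forall fun ω ↦ Real.norm_sign_le_one _)
    · exact (hY.integrable.const_mul c).mul_bdd hsY (.of_forall fun ω ↦ Real.norm_sign_le_one _)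
  rw [h3, h1, h2, zero_add, hc]
  have hs := Real.sqrt_pos.2 hVar
  field_simp
  rw [Real.sq_sqrt hVar.le]

lemma ofReal_integral_mul_le_eLpNorm_condExp {Ω : Type*} {m mΩ : MeasurableSpace Ω}
    {P : Measure Ω} [IsFiniteMeasure P] (hm : m ≤ mΩ) {X g : Ω → ℝ} (hX : Integrable X P)
    (hg : StronglyMeasurable[m] g) (hg1 : ∀ ω, ‖g ω‖ ≤ 1) :
    ENNReal.ofReal (∫ ω, X ω * g ω ∂P) ≤ eLpNorm (P[X | m]) 1 P := by
  have hg' : AEStronglyMeasurable g P := (hg.mono hm).aestronglyMeasurable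
  have hXg : Integrable (X * g) P := hX.mul_bdd hg' (.of_forall hg1)
  have h1 : ∫ ω, X ω * g ω ∂P = ∫ ω, (P[X | m]) ω * g ω ∂P := by
    rw [← integral_condExp hm (f := fun ω ↦ X ω * g ω)]
    exact integral_congr_ae (condExp_mul_of_stronglyMeasurable_right hg hXg hX)
  rw [eLpNorm_one_eq_lintegral_enorm, ← ofReal_integral_norm_eq_lintegral_enorm integrable_condExp,
    h1]
  refine ENNReal.ofReal_le_ofReal (integral_mono ?_ integrable_condExp.norm fun ω ↦ ?_)
  · exact integrable_condExp.mul_bdd hg' (.of_forall hg1)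
  · refine (Real.le_norm_self _).trans ?_
    rw [norm_mul]
    exact mul_le_of_le_one_right (norm_nonneg _) (hg1 ω)

/-! ### The covariance of sub-mixed fractional Brownian motion -/

/-- The process `c (B_t + B_{-t}) / √2`. A sub-mixed process is the sum of two of these, for
independent two-sided processes. -/
noncomputable def evenPart {Ω : Type*} (c : ℝ) (B : ℝ → Ω → ℝ) (t : ℝ≥0) (ω : Ω) : ℝ :=
  c / √2 * (B t ω + B (-t) ω)

lemma subMixedProcess_eq_evenPart_add {Ω : Type*} (a b : ℝ) (B B' : ℝ → Ω → ℝ) :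
    subMixedProcess a b B B' = fun t ω ↦ evenPart a B t ω + evenPart b B' t ω := by
  ext t ω
  simp only [subMixedProcess, evenPart]
  ring

/-- The increment of a process over the `k`-th interval of the grid of mesh `δ`. -/
def gridIncrement {Ω : Type*} (S : ℝ≥0 → Ω → ℝ) (δ : ℝ≥0) (k : ℕ) (ω : Ω) : ℝ :=
  S ((k + 1 : ℕ) * δ) ω - S (k * δ) ω

lemma gridIncrement_eq {Ω : Type*} (S : ℝ≥0 → Ω → ℝ) (δ : ℝ≥0) (k : ℕ) :
    gridIncrement S δ k = S ((k + 1 : ℕ) * δ) - S (k * δ) := rfl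

section Covariance

variable {Ω : Type*} [MeasurableSpace Ω] {P : Measure Ω}

lemma IsFractionalBrownianMotion.integral_sub_sq {H : ℝ} {B : ℝ → Ω → ℝ}
    (hB : IsFractionalBrownianMotion H B P) (s t : ℝ) :
    ∫ ω, (B s ω - B t ω) ^ 2 ∂P = |s - t| ^ (2 * H) := by
  have h := (hB.stationary_increments t {s - t}).comp
    (u := fun f : ({s - t} : Finset ℝ) → ℝ ↦ (f ⟨s - t, by simp⟩) ^ 2) (by fun_prop)
  have h1 := h.integral_eq
  simp only [Function.comp_def, sub_add_cancel] at h1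
  rw [h1, ← hB.second_moment (s - t)]
  refine integral_congr_ae ?_
  filter_upwards [hB.zero_ae] with ω hω
  rw [hω, sub_zero]

lemma IsFractionalBrownianMotion.memLp_two {H : ℝ} {B : ℝ → Ω → ℝ}
    (hB : IsFractionalBrownianMotion H B P) (t : ℝ) : MemLp (B t) 2 P :=
  (hB.isGaussianProcess.hasGaussianLaw_eval t).memLp_two

lemma IsFractionalBrownianMotion.covariance_eval {H : ℝ} {B : ℝ → Ω → ℝ}
    (hB : IsFractionalBrownianMotion H B P) (s t : ℝ) :
    cov[B s, B t; P] = (|s| ^ (2 * H) + |t| ^ (2 * H) - |s - t| ^ (2 * H)) / 2 := by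
  have := hB.isGaussianProcess.isProbabilityMeasure
  have hs := hB.memLp_two s
  have ht := hB.memLp_two t
  rw [covariance_eq_sub hs ht, hB.centered, zero_mul, sub_zero, ← hB.integral_sub_sq,
    ← hB.second_moment, ← hB.second_moment, ← integral_add hs.integrable_sq ht.integrable_sq,
    ← integral_sub (f := fun ω ↦ B s ω ^ 2 + B t ω ^ 2) (g := fun ω ↦ (B s ω - B t ω) ^ 2)
      (hs.integrable_sq.add ht.integrable_sq) (hs.sub ht).integrable_sq, ← integral_div]
  congr with ω
  simp only [Pi.mul_apply]
  ring

lemma IsTwoSidedPreBrownian.isGaussianProcess_evenPart {B : ℝ → Ω → ℝ}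
    (hB : IsTwoSidedPreBrownian B P) (c : ℝ) : IsGaussianProcess (evenPart c B) P :=
  (hB.right.isGaussianProcess.add_of_indepFun hB.left.isGaussianProcess hB.indep).smul
    fun _ ↦ c / √2

lemma IsFractionalBrownianMotion.isGaussianProcess_evenPart {H : ℝ} {B : ℝ → Ω → ℝ}
    (hB : IsFractionalBrownianMotion H B P) (c : ℝ) : IsGaussianProcess (evenPart c B) P := by
  classical
  exact hB.isGaussianProcess.of_isGaussianProcess fun t ↦ ⟨{(t : ℝ), -(t : ℝ)},
    (c / √2) • (.proj ⟨(t : ℝ), by simp⟩ + .proj ⟨-(t : ℝ), by simp⟩), fun ω ↦ by simp [evenPart, mul_add]⟩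

lemma covariance_evenPart {B : ℝ → Ω → ℝ} [IsFiniteMeasure P] (hB : ∀ t, MemLp (B t) 2 P) (c : ℝ)
    (s t : ℝ≥0) :
    cov[evenPart c B s, evenPart c B t; P] = c ^ 2 / 2 * (cov[B s, B t; P] + cov[B s, B (-t); P]
      + (cov[B (-s), B t; P] + cov[B (-s), B (-t); P])) := by
  have h (r : ℝ≥0) : evenPart c B r = (c / √2) • (B r + B (-r)) := by
    ext ω; simp [evenPart]
  rw [h, h, covariance_smul_left, covariance_smul_right,
    covariance_add_left (hB _) (hB _) ((hB _).add (hB _)),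
    covariance_add_right (hB _) (hB _) (hB _), covariance_add_right (hB _) (hB _) (hB _),
    ← mul_assoc, div_mul_div_comm, Real.mul_self_sqrt zero_le_two, sq]

lemma IsTwoSidedPreBrownian.memLp_two {B : ℝ → Ω → ℝ} (hB : IsTwoSidedPreBrownian B P) (t : ℝ) :
    MemLp (B t) 2 P := by
  rcases le_total 0 t with h | h
  · exact (hB.right.isGaussianProcess.hasGaussianLaw_eval ⟨t, h⟩).memLp_two
  · have := (hB.left.isGaussianProcess.hasGaussianLaw_eval (-t).toNNReal).memLp_two
    rwa [Real.coe_toNNReal _ (neg_nonneg.2 h), neg_neg] at this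

lemma IsTwoSidedPreBrownian.covariance_evenPart {B : ℝ → Ω → ℝ} [IsFiniteMeasure P]
    (hB : IsTwoSidedPreBrownian B P) (c : ℝ) (s t : ℝ≥0) :
    cov[evenPart c B s, evenPart c B t; P] = c ^ 2 * min (s : ℝ) t := by
  have h (s t : ℝ≥0) : cov[B s, B (-t); P] = 0 :=
    (hB.indep.comp (measurable_pi_apply s) (measurable_pi_apply t)).covariance_eq_zero
      (hB.memLp_two _) (hB.memLp_two _)
  have h1 := hB.right.covariance_eval s t
  have h2 := hB.left.covariance_eval s t
  rw [_root_.covariance_evenPart hB.memLp_two, h, covariance_comm (B (-s)), h, h1, h2,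
    NNReal.coe_min]
  ring

lemma IsFractionalBrownianMotion.covariance_evenPart {B : ℝ → Ω → ℝ}
    (hB : IsFractionalBrownianMotion (3 / 4) B P) (c : ℝ) (s t : ℝ≥0) :
    cov[evenPart c B s, evenPart c B t; P] =
      c ^ 2 * (fbmVar s + fbmVar t - (fbmVar (s - t) + fbmVar (s + t)) / 2) := by
  have := hB.isGaussianProcess.isProbabilityMeasure
  have h (s t : ℝ) : cov[B s, B t; P] = (fbmVar s + fbmVar t - fbmVar (s - t)) / 2 := by
    rw [hB.covariance_eval]
    norm_num [fbmVar]
  rw [_root_.covariance_evenPart hB.memLp_two, h, h, h, h, fbmVar_neg, fbmVar_neg,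
    ← fbmVar_neg (-s - t), ← fbmVar_neg (-s - -t)]
  ring_nf

variable {a b : ℝ} {S : ℝ≥0 → Ω → ℝ}

lemma IsSubMixedFBM.isGaussianProcess {H : ℝ} (hS : IsSubMixedFBM a b H S P) :
    IsGaussianProcess S P := by
  obtain ⟨B, B', hB, hB', hind, rfl⟩ := hS
  rw [subMixedProcess_eq_evenPart_add]
  refine (hB.isGaussianProcess_evenPart a).add_of_indepFun (hB'.isGaussianProcess_evenPart b) ?_
  have hm (c : ℝ) : Measurable fun (f : ℝ → ℝ) (t : ℝ≥0) ↦ c / √2 * (f t + f (-t)) := by fun_prop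
  exact hind.comp (hm a) (hm b)

lemma IsSubMixedFBM.integral_eval {H : ℝ} (hS : IsSubMixedFBM a b H S P) (t : ℝ≥0) :
    P[S t] = 0 := by
  obtain ⟨B, B', hB, hB', hind, rfl⟩ := hS
  have h1 := hB.right.integral_eval t
  have h2 := hB.left.integral_eval t
  have := hB'.isGaussianProcess.isProbabilityMeasure
  have hi (t : ℝ) : Integrable (B t) P := (hB.memLp_two t).integrable one_le_two
  have hi' (t : ℝ) : Integrable (B' t) P := (hB'.memLp_two t).integrable one_le_two
  have h3 : Integrable (fun ω ↦ a * (B t ω + B (-t) ω)) P := ((hi _).add (hi _)).const_mul a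
  have h4 : Integrable (fun ω ↦ b * (B' t ω + B' (-t) ω)) P := ((hi' _).add (hi' _)).const_mul b
  simp only [subMixedProcess]
  rw [integral_div, integral_add h3 h4, integral_const_mul, integral_const_mul,
    integral_add (hi _) (hi _), integral_add (hi' _) (hi' _), h1, h2, hB'.centered, hB'.centered]
  simp

lemma IsSubMixedFBM.covariance_eval (hS : IsSubMixedFBM a b (3 / 4) S P) (s t : ℝ≥0) :
    cov[S s, S t; P] = a ^ 2 * min (s : ℝ) t +
      b ^ 2 * (fbmVar s + fbmVar t - (fbmVar (s - t) + fbmVar (s + t)) / 2) := by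
  obtain ⟨B, B', hB, hB', hind, rfl⟩ := hS
  have := hB'.isGaussianProcess.isProbabilityMeasure
  have hE (t : ℝ≥0) := ((hB.isGaussianProcess_evenPart a).hasGaussianLaw_eval t).memLp_two
  have hF (t : ℝ≥0) := ((hB'.isGaussianProcess_evenPart b).hasGaussianLaw_eval t).memLp_two
  have hm (c : ℝ) (t : ℝ≥0) : Measurable fun (f : ℝ → ℝ) ↦ c / √2 * (f t + f (-t)) := by fun_prop
  have h0 (s t : ℝ≥0) : cov[evenPart a B s, evenPart b B' t; P] = 0 :=
    (hind.comp (hm a s) (hm b t)).covariance_eq_zero (hE s) (hF t)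
  have h (r : ℝ≥0) : subMixedProcess a b B B' r = evenPart a B r + evenPart b B' r := by
    rw [subMixedProcess_eq_evenPart_add]; rfl
  rw [h, h, covariance_add_left (hE _) (hF _) ((hE _).add (hF _)),
    covariance_add_right (hE _) (hE _) (hF _), covariance_add_right (hF _) (hE _) (hF _), h0,
    covariance_comm (evenPart b B' s), h0, hB.covariance_evenPart, hB'.covariance_evenPart]
  ring

lemma IsSubMixedFBM.covariance_gridIncrement (hS : IsSubMixedFBM a b (3 / 4) S P) (δ : ℝ≥0)
    (j k : ℕ) :
    cov[gridIncrement S δ j, gridIncrement S δ k; P] = a ^ 2 * δ * (if j = k then 1 else 0) +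
      b ^ 2 * fbmVar δ * (noiseCov (j - k) - noiseCov (j + k + 1)) := by
  have := hS.isGaussianProcess.isProbabilityMeasure
  have hL (t : ℝ≥0) := (hS.isGaussianProcess.hasGaussianLaw_eval t).memLp_two
  have hmin (j k : ℕ) : min (((j * δ : ℝ≥0)) : ℝ) ((k * δ : ℝ≥0) : ℝ) = ((min j k : ℕ) : ℝ) * δ := by
    rw [← NNReal.coe_min, ← min_mul_of_nonneg _ _ zero_le, ← Nat.cast_min]
    simp
  have hite : ((min (j + 1) (k + 1) : ℕ) : ℝ) - (min (j + 1) k : ℕ) - (min j (k + 1) : ℕ)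
      + (min j k : ℕ) = if j = k then 1 else 0 := by
    have : ((min (j + 1) (k + 1) : ℕ) : ℤ) - (min (j + 1) k : ℕ) - (min j (k + 1) : ℕ)
        + (min j k : ℕ) = if j = k then 1 else 0 := by
      split_ifs <;> omega
    exact_mod_cast this
  have hc (j k : ℕ) : cov[S (j * δ), S (k * δ); P] = a ^ 2 * (((min j k : ℕ) : ℝ) * δ) +
      b ^ 2 * fbmVar δ * (fbmVar j + fbmVar k - (fbmVar (j - k) + fbmVar (j + k)) / 2) := by
    rw [hS.covariance_eval, hmin]
    push_cast
    rw [← sub_mul, ← add_mul, fbmVar_mul, fbmVar_mul, fbmVar_mul, fbmVar_mul]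
    ring
  rw [gridIncrement_eq, gridIncrement_eq, covariance_sub_sub (hL _) (hL _) (hL _) (hL _), hc, hc,
    hc, hc, ← hite, noiseCov, noiseCov]
  push_cast
  ring_nf

end Covariance

/-! ### Prediction of an increment from the preceding ones -/

/-- A linear functional of the `M` grid increments that precede the `j`-th one, with the weight
`(i + 1) ^ (-1 / 2)` on the increment at distance `i + 1`. The weights imitate the decay of the
covariances of these increments with the `j`-th one. -/
noncomputable def weightedPast {Ω : Type*} (S : ℝ≥0 → Ω → ℝ) (δ : ℝ≥0) (M j : ℕ) (ω : Ω) : ℝ :=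
  ∑ i ∈ Finset.range M, (√(i + 1 : ℝ))⁻¹ * gridIncrement S δ (j - (i + 1)) ω

/-- The partial sums of the harmonic series. -/
noncomputable def harmonicSum (M : ℕ) : ℝ := ∑ i ∈ Finset.range M, 1 / ((i : ℝ) + 1)

lemma harmonicSum_pos {M : ℕ} (hM : 0 < M) : 0 < harmonicSum M :=
  Finset.sum_pos (fun i _ ↦ by positivity) ⟨0, Finset.mem_range.2 hM⟩

lemma sum_sq_inv_sqrt (M : ℕ) :
    ∑ i ∈ Finset.range M, (√(i + 1 : ℝ))⁻¹ ^ 2 = harmonicSum M :=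
  Finset.sum_congr rfl fun i _ ↦ by rw [inv_pow, Real.sq_sqrt (by positivity), one_div]

section LowerBound

variable {Ω : Type*} [MeasurableSpace Ω] {P : Measure Ω} {a b : ℝ} {S : ℝ≥0 → Ω → ℝ}

lemma ProbabilityTheory.IsGaussianProcess.gridIncrement (hS : IsGaussianProcess S P) (δ : ℝ≥0) :
    IsGaussianProcess (gridIncrement S δ) P := by
  classical
  exact hS.of_isGaussianProcess fun k ↦ ⟨{(k + 1 : ℕ) * δ, k * δ},
    .proj ⟨(k + 1 : ℕ) * δ, by simp⟩ - .proj ⟨k * δ, by simp⟩, fun ω ↦ by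
      simp [_root_.gridIncrement]⟩

lemma ProbabilityTheory.IsGaussianProcess.hasGaussianLaw_gridIncrement_weightedPast
    (hS : IsGaussianProcess S P) (δ : ℝ≥0) (M j : ℕ) :
    HasGaussianLaw (fun ω ↦ (_root_.gridIncrement S δ j ω, weightedPast S δ M j ω)) P :=
  (hS.gridIncrement δ).hasGaussianLaw_prodMk_sum j _ _ _

lemma IsSubMixedFBM.integral_gridIncrement {H : ℝ} (hS : IsSubMixedFBM a b H S P) (δ : ℝ≥0)
    (k : ℕ) : P[gridIncrement S δ k] = 0 := by
  have hi (t : ℝ≥0) := (hS.isGaussianProcess.hasGaussianLaw_eval t).integrable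
  simp only [gridIncrement]
  rw [integral_sub (hi _) (hi _), hS.integral_eval, hS.integral_eval, sub_zero]

lemma IsSubMixedFBM.integral_weightedPast {H : ℝ} (hS : IsSubMixedFBM a b H S P) (δ : ℝ≥0)
    (M j : ℕ) : P[weightedPast S δ M j] = 0 := by
  have hi (k : ℕ) := ((hS.isGaussianProcess.gridIncrement δ).hasGaussianLaw_eval k).integrable
  simp only [weightedPast]
  rw [integral_finsetSum _ fun i _ ↦ (hi _).const_mul _]
  exact Finset.sum_eq_zero fun i _ ↦ by rw [integral_const_mul, hS.integral_gridIncrement, mul_zero]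

/-- The lower bound on `j` keeps the reflected argument `j + k + 1` at least four times `j - k`, so that
`noiseCov_sub_noiseCov_ge` applies to every summand. -/
lemma IsSubMixedFBM.covariance_gridIncrement_weightedPast_ge (hS : IsSubMixedFBM a b (3 / 4) S P)
    (δ : ℝ≥0) {M j : ℕ} (hj : 3 * M ≤ j) :
    b ^ 2 * fbmVar δ * (harmonicSum M / 16) ≤
      cov[gridIncrement S δ j, weightedPast S δ M j; P] := by
  have := hS.isGaussianProcess.isProbabilityMeasure
  have hL (k : ℕ) := ((hS.isGaussianProcess.gridIncrement δ).hasGaussianLaw_eval k).memLp_two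
  unfold weightedPast
  rw [covariance_fun_sum_right' (fun i _ ↦ (hL _).const_mul _) (hL j), ← sum_sq_inv_sqrt,
    Finset.sum_div, Finset.mul_sum]
  refine Finset.sum_le_sum fun i hi ↦ ?_
  have hiM : i + 1 ≤ M := Finset.mem_range.1 hi
  have hiM' : (i : ℝ) + 1 ≤ M := by exact_mod_cast hiM
  have hj' : 3 * (M : ℝ) ≤ j := by exact_mod_cast hj
  rw [covariance_const_mul_right, hS.covariance_gridIncrement, if_neg (by omega),
    Nat.cast_sub (by omega), Nat.cast_add_one, mul_zero, zero_add, sub_sub_cancel]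
  have h := noiseCov_sub_noiseCov_ge (x := i + 1) (y := j + (j - (i + 1)) + 1)
    (by linarith [(Nat.cast_nonneg i : (0 : ℝ) ≤ i)]) (by linarith)
  have hψ : 0 ≤ b ^ 2 * fbmVar δ := by unfold fbmVar; positivity
  calc b ^ 2 * fbmVar δ * ((√((i : ℝ) + 1))⁻¹ ^ 2 / 16)
      = (√((i : ℝ) + 1))⁻¹ * (b ^ 2 * fbmVar δ * (1 / 16 / √((i : ℝ) + 1))) := by ring
    _ ≤ _ := by gcongr

/-- The Brownian part contributes the diagonal term `a ^ 2`. In the fractional part the reflected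
covariances are dropped and the others are bounded by Schur's test. -/
lemma IsSubMixedFBM.variance_weightedPast_le (hS : IsSubMixedFBM a b (3 / 4) S P)
    (δ : ℝ≥0) {M j : ℕ} (hj : M ≤ j) :
    Var[weightedPast S δ M j; P] ≤ δ * harmonicSum M * (a ^ 2 + 2 * b ^ 2 * √(δ * M)) := by
  have := hS.isGaussianProcess.isProbabilityMeasure
  have hL (k : ℕ) := ((hS.isGaussianProcess.gridIncrement δ).hasGaussianLaw_eval k).memLp_two
  have hY := (hS.isGaussianProcess.hasGaussianLaw_gridIncrement_weightedPast δ M j).snd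
  rw [← covariance_self hY.aemeasurable]
  unfold weightedPast
  rw [covariance_fun_sum_fun_sum' (fun i _ ↦ (hL _).const_mul _) (fun i _ ↦ (hL _).const_mul _)]
  set w : ℕ → ℝ := fun i ↦ (√(i + 1 : ℝ))⁻¹ with hw
  have hw0 (i : ℕ) : 0 ≤ w i := by positivity
  have hψ : 0 ≤ b ^ 2 * fbmVar δ := by unfold fbmVar; positivity
  have hle : ∀ i ∈ Finset.range M, ∀ l ∈ Finset.range M,
      cov[fun ω ↦ w i * gridIncrement S δ (j - (i + 1)) ω,
        fun ω ↦ w l * gridIncrement S δ (j - (l + 1)) ω; P] ≤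
      a ^ 2 * δ * (if i = l then w i * w l else 0) +
        b ^ 2 * fbmVar δ * (w i * w l * noiseCov ((i : ℝ) - l)) := by
    intro i hi l hl
    have hi' := Finset.mem_range.1 hi
    have hl' := Finset.mem_range.1 hl
    rw [covariance_const_mul_left, covariance_const_mul_right, hS.covariance_gridIncrement]
    have h1 : noiseCov (((j - (i + 1) : ℕ) : ℝ) - (j - (l + 1) : ℕ)) = noiseCov ((i : ℝ) - l) := by
      rw [Nat.cast_sub (by omega), Nat.cast_sub (by omega), ← noiseCov_neg]
      push_cast
      ring_nf
    -- this is the reflected term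
    have h2 : 0 ≤ noiseCov (((j - (i + 1) : ℕ) : ℝ) + (j - (l + 1) : ℕ) + 1) := by
      exact_mod_cast noiseCov_natCast_nonneg ((j - (i + 1)) + (j - (l + 1)) + 1)
    have h3 : (if j - (i + 1) = j - (l + 1) then (1 : ℝ) else 0) = if i = l then 1 else 0 :=
      if_congr (by omega) rfl rfl
    have h4 : (if i = l then w i * w l else 0) = w i * w l * (if i = l then 1 else 0) := by simp
    rw [h1, h3, h4]
    nlinarith [mul_nonneg (mul_nonneg (hw0 i) (hw0 l)) (mul_nonneg hψ h2)]
  refine (Finset.sum_le_sum fun i hi ↦ Finset.sum_le_sum (hle i hi)).trans ?_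
  simp_rw [Finset.sum_add_distrib, ← Finset.mul_sum]
  have hdiag : ∑ i ∈ Finset.range M, ∑ l ∈ Finset.range M, (if i = l then w i * w l else 0)
      = harmonicSum M := by
    rw [← sum_sq_inv_sqrt]
    refine Finset.sum_congr rfl fun i hi ↦ ?_
    rw [Finset.sum_ite_eq, if_pos hi, sq]
  have hschur := sum_sum_mul_le_of_row_sum_le (s := Finset.range M)
    (k := fun i l : ℕ ↦ noiseCov ((i : ℝ) - l)) (w := w) (C := 2 * √M)
    (fun i _ l _ ↦ noiseCov_natCast_sub_nonneg i l)
    (fun i _ l _ ↦ by rw [← noiseCov_neg, neg_sub])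
    (fun i hi ↦ sum_noiseCov_le (Finset.mem_range.1 hi))
  rw [sum_sq_inv_sqrt] at hschur
  rw [hdiag]
  have hδ : fbmVar δ * √M = δ * √(δ * M) := by
    rw [fbmVar_of_nonneg δ.coe_nonneg, Real.sqrt_mul δ.coe_nonneg]; ring
  calc _ ≤ a ^ 2 * δ * harmonicSum M + b ^ 2 * fbmVar δ * (2 * √M * harmonicSum M) := by gcongr
    _ = _ := by linear_combination (2 * b ^ 2 * harmonicSum M) * hδ

end LowerBound

/-- The factor `√(harmonicSum M)` is the gain that makes the sums of the conditional increments
diverge, because `δ` is `T / (4 * M)` and `M` increments have this lower bound. -/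
lemma IsSubMixedFBM.le_eLpNorm_condExp_gridIncrement {Ω : Type*} {m mΩ : MeasurableSpace Ω}
    {P : Measure Ω} {a b : ℝ} {S : ℝ≥0 → Ω → ℝ} (hS : IsSubMixedFBM a b (3 / 4) S P)
    (hb : b ≠ 0) {δ : ℝ≥0} (hδ : 0 < δ) {M j : ℕ} (hM : 0 < M) (hj : 3 * M ≤ j)
    (hm : m ≤ mΩ) (hY : Measurable[m] (weightedPast S δ M j)) :
    ENNReal.ofReal (gaussianAbsMoment * (b ^ 2 * δ * √(harmonicSum M) /
        (16 * √(a ^ 2 + 2 * b ^ 2 * √(δ * M))))) ≤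
      eLpNorm (P[gridIncrement S δ j | m]) 1 P := by
  have := hS.isGaussianProcess.isProbabilityMeasure
  have hXY := hS.isGaussianProcess.hasGaussianLaw_gridIncrement_weightedPast δ M j
  have hcov := hS.covariance_gridIncrement_weightedPast_ge δ hj
  have hvar := hS.variance_weightedPast_le δ (show M ≤ j by omega)
  have hH := harmonicSum_pos hM
  have hδ' : (0 : ℝ) < δ := hδ
  have hM' : (0 : ℝ) < M := by exact_mod_cast hM
  set K := a ^ 2 + 2 * b ^ 2 * √(δ * M) with hK
  have hK0 : 0 < K := by positivity
  rw [fbmVar_of_nonneg hδ'.le] at hcov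
  have hcov0 : 0 < cov[gridIncrement S δ j, weightedPast S δ M j; P] :=
    lt_of_lt_of_le (by positivity) hcov
  have hvar0 : 0 < Var[weightedPast S δ M j; P] := by
    -- otherwise `weightedPast` would be almost surely constant and the covariance would vanish
    refine (variance_nonneg _ _).lt_of_ne fun h ↦ hcov0.ne' ?_
    have h0 := ae_eq_integral_of_variance_eq_zero hXY.snd.memLp_two h.symm
    rw [covariance]
    refine integral_eq_zero_of_ae ?_
    filter_upwards [h0] with ω hω
    rw [hω, sub_self, mul_zero, Pi.zero_apply]
  refine le_trans (ENNReal.ofReal_le_ofReal ?_) (ofReal_integral_mul_le_eLpNorm_condExp hm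
    hXY.fst.integrable (g := fun ω ↦ Real.sign (weightedPast S δ M j ω))
    (Real.measurable_sign.comp hY).stronglyMeasurable fun ω ↦ Real.norm_sign_le_one _)
  rw [hXY.integral_mul_sign (hS.integral_gridIncrement δ j) (hS.integral_weightedPast δ M j) hvar0]
  refine mul_le_mul_of_nonneg_left ?_ gaussianAbsMoment_pos.le
  have hsd : √(Var[weightedPast S δ M j; P]) ≤ √δ * √(harmonicSum M) * √K := by
    rw [← Real.sqrt_mul hδ'.le, ← Real.sqrt_mul (by positivity)]
    exact Real.sqrt_le_sqrt hvar
  have h1 := Real.sq_sqrt hH.le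
  have h2 := Real.sqrt_pos.2 hH
  have h3 := Real.sqrt_pos.2 hδ'
  have h4 := Real.sqrt_pos.2 hK0
  calc b ^ 2 * δ * √(harmonicSum M) / (16 * √K)
      = b ^ 2 * (δ * √δ) * (harmonicSum M / 16) / (√δ * √(harmonicSum M) * √K) := by
        field_simp
        rw [h1]
    _ ≤ _ := div_le_div₀ hcov0.le hcov (Real.sqrt_pos.2 hvar0) hsd

/-! ### Divergence along uniform partitions -/

theorem mainTheorem3 {Ω : Type*} [MeasurableSpace Ω] (P : Measure Ω) [IsProbabilityMeasure P]
    (a b : ℝ) (hb : b ≠ 0) (S : ℝ≥0 → Ω → ℝ) (hS : IsSubMixedFBM a b (3 / 4) S P)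
    (T : ℝ≥0) (hT : 0 < T) :
    ¬ IsQuasiMartingale (fun t : Set.Iic T ↦ S (t : ℝ≥0)) P := by
  rintro ⟨hX, -, hfin⟩
  set V := ⨆ (n : ℕ) (t : Fin (n + 1) → Set.Iic T)
      (_ : StrictMono t ∧ (t 0 : ℝ≥0) = 0 ∧ (t (Fin.last n) : ℝ≥0) = T),
      ∑ j : Fin n, eLpNorm
        (condExp (Filtration.natural (fun t : Set.Iic T ↦ S (t : ℝ≥0)) hX (t j.castSucc)) P
          (S (t j.succ) - S (t j.castSucc))) 1 P
  set c := gaussianAbsMoment * (b ^ 2 * T / (64 * √(a ^ 2 + 2 * b ^ 2 * √(T / 4)))) with hc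
  have hT' : (0 : ℝ) < T := hT
  have hc0 : 0 < c := by have := gaussianAbsMoment_pos; positivity
  -- the partition into `4 M` intervals, of which only the last `M` are used
  have key (M : ℕ) (hM : 0 < M) : ENNReal.ofReal (c * √(harmonicSum M)) ≤ V := by
    have hM' : (0 : ℝ) < M := by exact_mod_cast hM
    set δ : ℝ≥0 := T / (4 * M : ℕ) with hδdef
    have hδ : 0 < δ := by positivity
    have hnδ : (4 * M : ℕ) * δ = T := mul_div_cancel₀ _ (by positivity)
    have hδM : (δ : ℝ) * M = T / 4 := by
      rw [← hnδ]; push_cast; ring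
    have hle (k : ℕ) (hk : k ≤ 4 * M) : k * δ ≤ T := by
      calc k * δ ≤ (4 * M : ℕ) * δ := by gcongr
        _ = T := hnδ
    let t (k : Fin (4 * M + 1)) : Set.Iic T := ⟨(k : ℕ) * δ, hle k (by omega)⟩
    have ht : StrictMono t ∧ (t 0 : ℝ≥0) = 0 ∧ (t (Fin.last (4 * M)) : ℝ≥0) = T := by
      refine ⟨fun k l hkl ↦ ?_, by simp [t], by simpa [t] using hnδ⟩
      have : (k : ℕ) < (l : ℕ) := hkl
      change ((k : ℕ) : ℝ≥0) * δ < (l : ℕ) * δ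
      gcongr
    refine le_trans ?_ (le_iSup_of_le (4 * M) (le_iSup_of_le t (le_iSup_of_le ht le_rfl)))
    set d := ENNReal.ofReal (gaussianAbsMoment * (b ^ 2 * δ * √(harmonicSum M) /
        (16 * √(a ^ 2 + 2 * b ^ 2 * √(δ * M))))) with hd
    calc ENNReal.ofReal (c * √(harmonicSum M)) = M * d := by
          rw [← ENNReal.ofReal_natCast M, hd, ← ENNReal.ofReal_mul hM'.le, hc, ← hδM]
          congr 1
          have : (T : ℝ) = 4 * (δ * M) := by rw [hδM]; ring
          rw [this]
          ring
      _ = ∑ j ∈ Finset.range (3 * M + M), if 3 * M ≤ j then d else 0 := by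
          rw [Finset.sum_range_add, Finset.sum_eq_zero fun j hj ↦
            if_neg (by simpa using hj)]
          simp
      _ = ∑ j : Fin (4 * M), if 3 * M ≤ (j : ℕ) then d else 0 := by
          rw [Fin.sum_univ_eq_sum_range (fun j ↦ if 3 * M ≤ j then d else 0),
            show 3 * M + M = 4 * M by ring]
      _ ≤ _ := by
          refine Finset.sum_le_sum fun j _ ↦ ?_
          split_ifs with hj
          swap
          · exact zero_le
          refine hS.le_eLpNorm_condExp_gridIncrement hb hδ hM hj (Filtration.le _ _) ?_
          have hmeas (k : ℕ) (hk : k ≤ j) :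
              Measurable[Filtration.natural (fun t : Set.Iic T ↦ S (t : ℝ≥0)) hX (t j.castSucc)]
                (S (k * δ)) := by
            have hkj : (⟨k * δ, hle k (by omega)⟩ : Set.Iic T) ≤ t j.castSucc := by
              change (k : ℝ≥0) * δ ≤ (j : ℕ) * δ
              gcongr
            exact ((Filtration.stronglyAdapted_natural hX _).mono
              (Filtration.mono _ hkj)).measurable
          refine Finset.measurable_fun_sum _ fun i hi ↦ ?_
          have hi' := Finset.mem_range.1 hi
          exact (((hmeas _ (by omega)).sub (hmeas _ (by omega))).const_mul _)
  have hbd (M : ℕ) (hM : 0 < M) : harmonicSum M ≤ (V.toReal / c) ^ 2 := by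
    have h1 := (ENNReal.ofReal_le_iff_le_toReal hfin.ne).1 (key M hM)
    rw [mul_comm, ← le_div_iff₀ hc0] at h1
    exact (Real.sqrt_le_left (by positivity)).1 h1
  obtain ⟨M, hM, hM0⟩ := ((Real.tendsto_sum_range_one_div_nat_succ_atTop.eventually_gt_atTop
    ((V.toReal / c) ^ 2)).and (Filter.eventually_gt_atTop 0)).exists
  exact absurd (hbd M hM0) hM.not_ge
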